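/- For complex numbers $\mu_1,\dots,\mu_r$ ($r\ge 0$) let $E_{(\mu_1,\dots,\mu_r)}$ be the space of all $f\in C^\infty(\mathbb R,\mathbb C)$ with $\left(\frac{d}{dx}-\mu_1\right)\cdots\left(\frac{d}{dx}-\mu_r\right)f=0$. For real $a<b$ and $r\ge 1$, the Bernstein basis of this space with respect to $a,b$ is the system $p_{(\mu_1,\dots,\mu_r),k}\in E_{(\mu_1,\dots,\mu_r)}$, $k=0,\dots,r-1$, such that $p_{(\mu_1,\dots,\mu_r),k}$ has a zero of order exactly $k$ at $a$ and a zero of order exactly $r-1-k$ at $b$, normalized by $p^{(k)}_{(\mu_1,\dots,\mu_r),k}(a)=1$. Theorem. Let $n\ge 1$ and $\lambda_2,\dots,\lambda_n\in\mathbb C$ be such that $E_{(\lambda_2,\dots,\lambda_n)}$ is closed under complex conjugation ($f\in E$ implies $\overline f\in E$), and put $M_n=\max\{|\operatorname{Im}\lambda_j| : j=2,\dots,n\}$ (with $M_n=0$ if $n=1$). Let $a,b\in\mathbb R$ with $0<b-a<\pi/M_n$, where the upper bound is read as $+\infty$ if $M_n=0$. Then for every real $\lambda$ the space $E_{(\lambda,\lambda_2,\dots,\lambda_n)}$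 has a unique Bernstein basis with respect to $a,b$, and for every $k\in\{0,\dots,n-1\}$ the following hold. 1. For all real $\lambda_0<\lambda_1$ the limit below exists, is real, and satisfies $$\lim_{x\to b}\frac{p_{(\lambda_0,\lambda_2,\dots,\lambda_n),k}(x)}{p_{(\lambda_1,\lambda_2,\dots,\lambda_n),k}(x)}<1.$$ 2. For each $x\in(a,b)$ the values $p_{(\lambda,\lambda_2,\dots,\lambda_n),k}(x)$, $\lambda\in\mathbb R$, are real, and the function $\lambda\mapsto p_{(\lambda,\lambda_2,\dots,\lambda_n),k}(x)$ is strictly increasing on $\mathbb R$. -/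

import Mathlib

open scoped ContDiff Topology

/-- The differential operator `(d/dx - Λ 0) ∘ ⋯ ∘ (d/dx - Λ (m-1))` acting on functions `ℝ → ℂ`;
for `m = 0` it is the identity. -/
noncomputable def expDiffOp {m : ℕ} (Λ : Fin m → ℂ) (f : ℝ → ℂ) : ℝ → ℂ :=
  (List.ofFn Λ).foldr (fun c g x => deriv g x - c * g x) f

/-- The space `E_Λ` of exponential polynomials: the smooth functions `f : ℝ → ℂ` such that
`f` is annihilated by the differential operator with eigenvalues `Λ`. -/
def expPolySpace {m : ℕ} (Λ : Fin m → ℂ) : Set (ℝ → ℂ) :=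
  {f | ContDiff ℝ ∞ f ∧ ∀ x, expDiffOp Λ f x = 0}

/-- A set of complex-valued functions is closed under complex conjugation. -/
def ClosedUnderConj (E : Set (ℝ → ℂ)) : Prop :=
  ∀ f ∈ E, (fun x => (starRingEnd ℂ) (f x)) ∈ E

/-- `f` has a zero of order (multiplicity) exactly `k` at `a`. -/
def HasZeroOfOrder (f : ℝ → ℂ) (k : ℕ) (a : ℝ) : Prop :=
  (∀ j < k, iteratedDeriv j f a = 0) ∧ iteratedDeriv k f a ≠ 0

/-- `p 0, …, p n` is the (normalized) Bernstein basis of `E_Λ`, `Λ = (Λ 0, …, Λ n)`, with respect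
to `a` and `b`: `p k` lies in `E_Λ`, has a zero of order `k` at `a` and a zero of order `n - k`
at `b`, and its `k`-th derivative at `a` equals `1`. -/
def IsBernsteinBasis {n : ℕ} (Λ : Fin (n + 1) → ℂ) (a b : ℝ) (p : Fin (n + 1) → ℝ → ℂ) : Prop :=
  ∀ k : Fin (n + 1), p k ∈ expPolySpace Λ ∧
    HasZeroOfOrder (p k) k a ∧ HasZeroOfOrder (p k) (n - k) b ∧
    iteratedDeriv k (p k) a = 1

open Classical in
/-- The Bernstein basis function `p_{Λ,k}` of `E_Λ` with respect to `a` and `b` (the zero function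
if there is no Bernstein basis). -/
noncomputable def bernsteinFun {n : ℕ} (Λ : Fin (n + 1) → ℂ) (a b : ℝ) (k : Fin (n + 1)) :
    ℝ → ℂ :=
  if h : ∃ p, IsBernsteinBasis Λ a b p then h.choose k else 0

/-- `max_j |Im (Λ j)|`, which is `0` for the empty tuple. -/
noncomputable def maxAbsIm {m : ℕ} (Λ : Fin m → ℂ) : ℝ := ⨆ j, |(Λ j).im|

open Polynomial

/-- `Alternates K a φ r τ y` says that there are points `a < x₀ < ⋯ < x_r = y` at which `φ`
alternates in sign, where `τ` is the sign at `y` and membership in `K` stands for positivity. -/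
inductive Alternates (K : ConvexCone ℝ ℝ) (a : ℝ) (φ : ℝ → ℝ) : ℕ → ℝ → ℝ → Prop
  | base {τ y : ℝ} : a < y → τ * φ y ∈ K → Alternates K a φ 0 τ y
  | step {r : ℕ} {τ y z : ℝ} : Alternates K a φ r τ y → y < z → -τ * φ z ∈ K →
      Alternates K a φ (r + 1) (-τ) z

namespace Alternates

variable {K : ConvexCone ℝ ℝ} {a b : ℝ} {φ φ' : ℝ → ℝ} {r : ℕ} {τ y : ℝ}

lemma lt (h : Alternates K a φ r τ y) : a < y := by
  induction h with
  | base h _ => exact h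
  | step _ h₁ _ ih => exact ih.trans h₁

lemma mem (h : Alternates K a φ r τ y) : τ * φ y ∈ K := by
  cases h with
  | base _ h => exact h
  | step _ _ h => exact h

lemma of_pos_mul {c ψ : ℝ → ℝ} (h : Alternates K a φ r τ y) (hy : y < b)
    (hc : ∀ x ∈ Set.Ioo a b, 0 < c x ∧ ψ x = c x * φ x) : Alternates K a ψ r τ y := by
  have key : ∀ σ x, x ∈ Set.Ioo a b → σ * φ x ∈ K → σ * ψ x ∈ K := by
    intro σ x hx h
    have := K.smul_mem (hc x hx).1 h
    rw [(hc x hx).2]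
    convert this using 1
    simp only [smul_eq_mul]; ring
  induction h with
  | base h h' => exact base h (key _ _ ⟨h, hy⟩ h')
  | step h₀ h₁ h₂ ih =>
    exact step (ih (h₁.trans hy)) h₁ (key _ _ ⟨h₀.lt.trans h₁, hy⟩ h₂)

end Alternates

lemma exists_deriv_mul_mem {K : ConvexCone ℝ ℝ} {φ φ' : ℝ → ℝ} {s t τ : ℝ} (hst : s < t)
    (hφ : ∀ x ∈ Set.Icc s t, HasDerivAt φ (φ' x) x) (h : τ * (φ t - φ s) ∈ K) :
    ∃ ξ ∈ Set.Ioo s t, τ * φ' ξ ∈ K := by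
  obtain ⟨ξ, hξ, he⟩ := exists_hasDerivAt_eq_slope φ φ' hst
    (fun x hx => (hφ x hx).continuousAt.continuousWithinAt)
    (fun x hx => hφ x (Set.Ioo_subset_Icc_self hx))
  refine ⟨ξ, hξ, ?_⟩
  have := K.smul_mem (inv_pos.2 (sub_pos.2 hst)) h
  rw [he]
  convert this using 1
  simp only [smul_eq_mul]; ring

namespace Alternates

variable {K : ConvexCone ℝ ℝ} {a b : ℝ} {φ φ' : ℝ → ℝ} {r : ℕ} {τ y : ℝ}

lemma exists_mem_between {z : ℝ} (hφ : ∀ x ∈ Set.Icc a b, HasDerivAt φ (φ' x) x)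
    (hay : a < y) (hyz : y < z) (hzb : z ≤ b) (hy : τ * φ y ∈ K)
    (hz : -τ * φ z ∈ K ∨ φ z = 0) : ∃ ξ ∈ Set.Ioo y z, -τ * φ' ξ ∈ K := by
  refine exists_deriv_mul_mem hyz (fun x hx => hφ x ⟨hay.le.trans hx.1, hx.2.trans hzb⟩) ?_
  rcases hz with hz | hz
  · convert K.add_mem hy hz using 1; ring
  · convert hy using 1; rw [hz]; ring

lemma deriv_of_zero (hφ : ∀ x ∈ Set.Icc a b, HasDerivAt φ (φ' x) x) (ha : φ a = 0)
    (h : Alternates K a φ r τ y) (hy : y < b) : ∃ z < y, Alternates K a φ' r τ z := by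
  induction h with
  | @base τ y h h' =>
    obtain ⟨ξ, hξ, hm⟩ := exists_deriv_mul_mem (K := K) (τ := τ) h
      (fun x hx => hφ x ⟨hx.1, hx.2.trans hy.le⟩) (by rw [ha, sub_zero]; exact h')
    exact ⟨ξ, hξ.2, base hξ.1 hm⟩
  | step h₀ h₁ h₂ ih =>
    obtain ⟨w, hw, hA⟩ := ih (h₁.trans hy)
    obtain ⟨ξ, hξ, hm⟩ := exists_mem_between hφ h₀.lt h₁ hy.le h₀.mem (Or.inl h₂)
    exact ⟨ξ, hξ.2, step hA (hw.trans hξ.1) hm⟩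

lemma deriv_of_succ (hφ : ∀ x ∈ Set.Icc a b, HasDerivAt φ (φ' x) x)
    (h : Alternates K a φ (r + 1) τ y) (hy : y < b) : ∃ z < y, Alternates K a φ' r τ z := by
  induction r generalizing τ y with
  | zero =>
    cases h with
    | step h₀ h₁ h₂ =>
      obtain ⟨ξ, hξ, hm⟩ := exists_mem_between hφ h₀.lt h₁ hy.le h₀.mem (Or.inl h₂)
      exact ⟨ξ, hξ.2, base (h₀.lt.trans hξ.1) hm⟩
  | succ r ih =>
    cases h with
    | step h₀ h₁ h₂ =>
      obtain ⟨w, hw, hA⟩ := ih h₀ (h₁.trans hy)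
      obtain ⟨ξ, hξ, hm⟩ := exists_mem_between hφ h₀.lt h₁ hy.le h₀.mem (Or.inl h₂)
      exact ⟨ξ, hξ.2, step hA (hw.trans hξ.1) hm⟩

end Alternates

/-- A sign pattern of `φ` on `(a, b)` which, together with zeros of multiplicity `k` at `a` and `l`
at `b`, forces an `n`-th order derivative of `φ` to take a value of sign `σ` on `(a, b)`. -/
def SignPattern (K : ConvexCone ℝ ℝ) (a b : ℝ) (φ : ℝ → ℝ) (n k l : ℕ) (σ : ℝ) : Prop :=
  ∃ r τ y, k + l + r = n ∧ τ * (-1) ^ l = σ ∧ y < b ∧ Alternates K a φ r τ y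

namespace SignPattern

variable {K : ConvexCone ℝ ℝ} {a b : ℝ} {φ φ' : ℝ → ℝ} {n k l : ℕ} {σ : ℝ}

lemma of_pos_mul {c ψ : ℝ → ℝ} (h : SignPattern K a b φ n k l σ)
    (hc : ∀ x ∈ Set.Ioo a b, 0 < c x ∧ ψ x = c x * φ x) : SignPattern K a b ψ n k l σ := by
  obtain ⟨r, τ, y, h₁, h₂, h₃, h₄⟩ := h
  exact ⟨r, τ, y, h₁, h₂, h₃, h₄.of_pos_mul h₃ hc⟩

lemma exists_mem (h : SignPattern K a b φ 0 k l σ) : ∃ ξ ∈ Set.Ioo a b, σ * φ ξ ∈ K := by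
  obtain ⟨r, τ, y, h₁, h₂, h₃, h₄⟩ := h
  obtain rfl : l = 0 := by omega
  refine ⟨y, ⟨h₄.lt, h₃⟩, ?_⟩
  rw [← h₂, pow_zero, mul_one]
  exact h₄.mem

lemma deriv (h : SignPattern K a b φ (n + 1) k l σ)
    (hφ : ∀ x ∈ Set.Icc a b, HasDerivAt φ (φ' x) x) (ha : 0 < k → φ a = 0)
    (hb : 0 < l → φ b = 0) : SignPattern K a b φ' n (k - 1) (l - 1) σ := by
  obtain ⟨r, τ, y, h₁, h₂, h₃, h₄⟩ := h
  have hlast : 0 < l → ∃ ξ ∈ Set.Ioo y b, -τ * φ' ξ ∈ K := fun hl =>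
    Alternates.exists_mem_between hφ h₄.lt h₃ le_rfl h₄.mem (Or.inr (hb hl))
  have hsign : ∀ j, l = j + 1 → -τ * (-1) ^ j = σ := by
    rintro j rfl
    rw [← h₂, pow_succ]; ring
  rcases Nat.eq_zero_or_pos k with rfl | hk
  · rcases l with _ | l
    · obtain ⟨r, rfl⟩ : ∃ s, r = s + 1 := ⟨n, by omega⟩
      obtain ⟨z, hz, hA⟩ := h₄.deriv_of_succ hφ h₃
      exact ⟨r, τ, z, by omega, h₂, hz.trans h₃, hA⟩
    · obtain ⟨ξ, hξ, hm⟩ := hlast (Nat.succ_pos _)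
      rcases r with _ | r
      · exact ⟨0, -τ, ξ, by omega, hsign _ rfl, hξ.2, .base (h₄.lt.trans hξ.1) hm⟩
      · obtain ⟨z, hz, hA⟩ := h₄.deriv_of_succ hφ h₃
        exact ⟨r + 1, -τ, ξ, by omega, hsign _ rfl, hξ.2, .step hA (hz.trans hξ.1) hm⟩
  · obtain ⟨z, hz, hA⟩ := h₄.deriv_of_zero hφ (ha hk) h₃
    rcases l with _ | l
    · exact ⟨r, τ, z, by omega, h₂, hz.trans h₃, hA⟩
    · obtain ⟨ξ, hξ, hm⟩ := hlast (Nat.succ_pos _)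
      exact ⟨r + 1, -τ, ξ, by omega, hsign _ rfl, hξ.2, .step hA (hz.trans hξ.1) hm⟩

end SignPattern

/-- The complex vector space of smooth functions `ℝ → ℂ`. -/
def smoothFun : Submodule ℂ (ℝ → ℂ) where
  carrier := {f | ContDiff ℝ ∞ f}
  add_mem' {f g} (hf : ContDiff ℝ ∞ f) (hg : ContDiff ℝ ∞ g) := hf.add hg
  zero_mem' := (contDiff_const : ContDiff ℝ ∞ fun _ : ℝ => (0 : ℂ))
  smul_mem' _ f (hf : ContDiff ℝ ∞ f) := contDiff_const.smul hf

lemma contDiff_deriv_of_contDiff_infty {f : ℝ → ℂ} (hf : ContDiff ℝ ∞ f) :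
    ContDiff ℝ ∞ (deriv f) := (contDiff_infty_iff_deriv.1 hf).2

lemma smoothFun.contDiff (F : smoothFun) : ContDiff ℝ ∞ (F : ℝ → ℂ) := F.2

lemma smoothFun.differentiable (F : smoothFun) : Differentiable ℝ (F : ℝ → ℂ) :=
  (smoothFun.contDiff F).differentiable (by simp)

/-- Differentiation on smooth functions. -/
noncomputable def derivOp : Module.End ℂ smoothFun where
  toFun F := ⟨deriv F, contDiff_deriv_of_contDiff_infty F.2⟩
  map_add' F G := by
    ext x
    exact deriv_add (smoothFun.differentiable F x) (smoothFun.differentiable G x)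
  map_smul' c F := by
    ext x
    exact deriv_const_smul c (smoothFun.differentiable F x)

lemma derivOp_apply (F : smoothFun) (x : ℝ) : (derivOp F : ℝ → ℂ) x = deriv F x := rfl

lemma smoothFun.hasDerivAt (F : smoothFun) (x : ℝ) :
    HasDerivAt (F : ℝ → ℂ) ((derivOp F : ℝ → ℂ) x) x := (smoothFun.differentiable F x).hasDerivAt

lemma derivOp_pow_apply (j : ℕ) (F : smoothFun) :
    ((derivOp ^ j) F : ℝ → ℂ) = iteratedDeriv j F := by
  induction j with
  | zero => simp
  | succ j ih =>
    rw [pow_succ', Module.End.mul_apply, iteratedDeriv_succ, ← ih]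
    rfl

/-- `F` has a zero of multiplicity at least `n` at `a`. -/
def VanishesToOrder (F : smoothFun) (n : ℕ) (a : ℝ) : Prop :=
  ∀ j < n, ((derivOp ^ j) F : ℝ → ℂ) a = 0

namespace VanishesToOrder

variable {F G : smoothFun} {n : ℕ} {a : ℝ}

lemma mono {k : ℕ} (h : VanishesToOrder F n a) (hk : k ≤ n) : VanishesToOrder F k a :=
  fun j hj => h j (hj.trans_le hk)

lemma apply_eq_zero (h : VanishesToOrder F n a) (hn : 0 < n) : (F : ℝ → ℂ) a = 0 := h 0 hn

lemma deriv (h : VanishesToOrder F n a) : VanishesToOrder (derivOp F) (n - 1) a := by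
  intro j hj
  have := h (j + 1) (by omega)
  rwa [pow_succ, Module.End.mul_apply] at this

lemma add (hF : VanishesToOrder F n a) (hG : VanishesToOrder G n a) :
    VanishesToOrder (F + G) n a := by
  intro j hj
  rw [map_add]
  simp [hF j hj, hG j hj]

lemma smul (c : ℂ) (hF : VanishesToOrder F n a) : VanishesToOrder (c • F) n a := by
  intro j hj
  rw [map_smul]
  simp [hF j hj]

lemma sub (hF : VanishesToOrder F n a) (hG : VanishesToOrder G n a) :
    VanishesToOrder (F - G) n a := by
  intro j hj
  rw [map_sub]
  simp [hF j hj, hG j hj]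

end VanishesToOrder

lemma smoothFun.hasDerivAt_re (F : smoothFun) (x : ℝ) :
    HasDerivAt (fun y => ((F : ℝ → ℂ) y).re) ((derivOp F : ℝ → ℂ) x).re x :=
  Complex.reCLM.hasFDerivAt.comp_hasDerivAt x (smoothFun.hasDerivAt F x)

section RealOperators

variable {K : ConvexCone ℝ ℝ} {a b : ℝ} {F : smoothFun} {n k l : ℕ} {σ : ℝ}

lemma SignPattern.linear_factor (c : ℝ)
    (h : SignPattern K a b (fun x => ((F : ℝ → ℂ) x).re) (n + 1) k l σ)
    (hk : VanishesToOrder F k a) (hl : VanishesToOrder F l b) :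
    SignPattern K a b (fun x => ((derivOp F - (c : ℂ) • F : smoothFun) : ℝ → ℂ) x |>.re)
      n (k - 1) (l - 1) σ := by
  have h₁ : SignPattern K a b (fun x => Real.exp (-c * x) * ((F : ℝ → ℂ) x).re) (n + 1) k l σ :=
    h.of_pos_mul fun x _ => ⟨Real.exp_pos _, rfl⟩
  have h₂ := h₁.deriv
    (φ' := fun x => Real.exp (-c * x) *
      (((derivOp F - (c : ℂ) • F : smoothFun) : ℝ → ℂ) x).re)
    (fun x _ => by
      have h := ((((hasDerivAt_id x).const_mul (-c)).exp).mul (smoothFun.hasDerivAt_re F x))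
      refine h.congr_deriv ?_
      simp; ring)
    (fun hk' => by simp [hk.apply_eq_zero hk'])
    (fun hl' => by simp [hl.apply_eq_zero hl'])
  refine h₂.of_pos_mul (c := fun x => Real.exp (c * x)) fun x _ => ⟨Real.exp_pos _, ?_⟩
  rw [← mul_assoc, ← Real.exp_add]
  simp

lemma SignPattern.quadratic_factor (α β : ℝ) (hβ : |β| * (b - a) < Real.pi)
    (h : SignPattern K a b (fun x => ((F : ℝ → ℂ) x).re) (n + 2) k l σ)
    (hk : VanishesToOrder F k a) (hl : VanishesToOrder F l b) :
    SignPattern K a b (fun x => ((derivOp (derivOp F) - ((2 * α : ℝ) : ℂ) • derivOp F +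
      ((α ^ 2 + β ^ 2 : ℝ) : ℂ) • F : smoothFun) : ℝ → ℂ) x |>.re)
      n (k - 1 - 1) (l - 1 - 1) σ := by
  set c : ℝ → ℝ := fun x => Real.exp (α * x) * Real.cos (β * (x - (a + b) / 2)) with hc
  set d : ℝ → ℝ := fun x => α * c x -
    Real.exp (α * x) * (β * Real.sin (β * (x - (a + b) / 2))) with hd
  have hcpos : ∀ x ∈ Set.Icc a b, 0 < c x := by
    intro x hx
    refine mul_pos (Real.exp_pos _) (Real.cos_pos_of_mem_Ioo (abs_lt.1 ?_))
    rw [abs_mul]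
    have : |x - (a + b) / 2| ≤ (b - a) / 2 := abs_le.2 ⟨by linarith [hx.1], by linarith [hx.2]⟩
    have := mul_le_mul_of_nonneg_left this (abs_nonneg β)
    linarith
  have hcd : ∀ x, HasDerivAt c (d x) x := by
    intro x
    have h₁ : HasDerivAt (fun x => Real.exp (α * x)) _ x := ((hasDerivAt_id x).const_mul α).exp
    have h₂ : HasDerivAt (fun x => Real.cos (β * (x - (a + b) / 2))) _ x :=
      (((hasDerivAt_id x).sub_const ((a + b) / 2)).const_mul β).cos
    refine (h₁.mul h₂).congr_deriv ?_
    simp [hd, hc]; ring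
  have hdd : ∀ x, HasDerivAt d (2 * α * d x - (α ^ 2 + β ^ 2) * c x) x := by
    intro x
    have h₁ : HasDerivAt (fun x => Real.exp (α * x)) _ x := ((hasDerivAt_id x).const_mul α).exp
    have h₂ : HasDerivAt (fun x => Real.sin (β * (x - (a + b) / 2))) _ x :=
      (((hasDerivAt_id x).sub_const ((a + b) / 2)).const_mul β).sin
    refine (((hcd x).const_mul α).sub (h₁.mul (h₂.const_mul β))).congr_deriv ?_
    simp [hd, hc]; ring
  set u : ℝ → ℝ := fun x => ((F : ℝ → ℂ) x).re with hu
  set v : ℝ → ℝ := fun x => ((derivOp F : ℝ → ℂ) x).re with hv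
  have hud : ∀ x, HasDerivAt u (v x) x := smoothFun.hasDerivAt_re F
  have hvd : ∀ x, HasDerivAt v (((derivOp (derivOp F) : ℝ → ℂ) x).re) x :=
    smoothFun.hasDerivAt_re _
  have hzero : ∀ {i : ℕ} {x : ℝ}, VanishesToOrder F i x → 0 < i → u x = 0 := fun h hi => by
    simp [hu, h.apply_eq_zero hi]
  have hzero' : ∀ {i : ℕ} {x : ℝ}, VanishesToOrder F i x → 0 < i - 1 → v x = 0 := fun h hi => by
    simp [hv, h.deriv.apply_eq_zero hi]
  have h₁ : SignPattern K a b (fun x => u x / c x) (n + 2) k l σ :=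
    h.of_pos_mul (c := fun x => (c x)⁻¹) fun x hx =>
      ⟨inv_pos.2 (hcpos x (Set.Ioo_subset_Icc_self hx)), div_eq_inv_mul _ _⟩
  have h₂ := h₁.deriv (fun x hx => (hud x).div (hcd x) (hcpos x hx).ne')
    (fun hk' => by simp [hzero hk hk']) (fun hl' => by simp [hzero hl hl'])
  have h₃ : SignPattern K a b (fun x => Real.exp (-(2 * α) * x) * (v x * c x - u x * d x))
      (n + 1) (k - 1) (l - 1) σ := by
    refine h₂.of_pos_mul (c := fun x => Real.exp (-(2 * α) * x) * c x ^ 2) fun x hx => ?_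
    have := hcpos x (Set.Ioo_subset_Icc_self hx)
    refine ⟨by positivity, ?_⟩
    field_simp
  have h₄ := h₃.deriv
    (φ' := fun x => Real.exp (-(2 * α) * x) * c x *
      (((derivOp (derivOp F) - ((2 * α : ℝ) : ℂ) • derivOp F +
        ((α ^ 2 + β ^ 2 : ℝ) : ℂ) • F : smoothFun) : ℝ → ℂ) x).re)
    (fun x _ => by
      have h := (((hasDerivAt_id x).const_mul (-(2 * α))).exp).mul
        (((hvd x).mul (hcd x)).sub ((hud x).mul (hdd x)))
      refine h.congr_deriv ?_
      have hre : (((derivOp (derivOp F) - ((2 * α : ℝ) : ℂ) • derivOp F +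
        ((α ^ 2 + β ^ 2 : ℝ) : ℂ) • F : smoothFun) : ℝ → ℂ) x).re =
        ((derivOp (derivOp F) : ℝ → ℂ) x).re - 2 * α * v x + (α ^ 2 + β ^ 2) * u x := by
        simp only [Submodule.coe_add, Submodule.coe_sub, Submodule.coe_smul, Pi.add_apply,
          Pi.sub_apply, Pi.smul_apply, Complex.add_re, Complex.sub_re, smul_eq_mul,
          Complex.re_ofReal_mul, hu, hv]
      rw [hre]
      simp only [id, mul_one]
      simp only [Pi.mul_apply, Pi.sub_apply]
      ring)
    (fun hk' => by simp [hzero hk (by omega), hzero' hk hk'])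
    (fun hl' => by simp [hzero hl (by omega), hzero' hl hl'])
  refine h₄.of_pos_mul (c := fun x => (Real.exp (-(2 * α) * x) * c x)⁻¹) fun x hx => ?_
  have := hcpos x (Set.Ioo_subset_Icc_self hx)
  have hpos : 0 < Real.exp (-(2 * α) * x) * c x := by positivity
  exact ⟨inv_pos.2 hpos, (inv_mul_cancel_left₀ hpos.ne' _).symm⟩

/-- The differential operator with complexified real coefficient polynomial `P`. -/
noncomputable abbrev realDiffOp (P : ℝ[X]) : Module.End ℂ smoothFun :=
  aeval derivOp (P.map (algebraMap ℝ ℂ))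

/-- Generalized Rolle theorem with signs, for a real constant coefficient operator which is
disconjugate on `[a, b]`. -/
theorem SignPattern.exists_realDiffOp_mem {P : ℝ[X]} (hP : P.Monic)
    (hroots : ∀ z : ℂ, aeval z P = 0 → |z.im| * (b - a) < Real.pi)
    (h : SignPattern K a b (fun x => ((F : ℝ → ℂ) x).re) P.natDegree k l σ)
    (hk : VanishesToOrder F k a) (hl : VanishesToOrder F l b) :
    ∃ ξ ∈ Set.Ioo a b, σ * ((realDiffOp P F : ℝ → ℂ) ξ).re ∈ K := by
  induction hn : P.natDegree using Nat.strong_induction_on generalizing P F k l with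
  | _ n ih =>
  rcases Nat.eq_zero_or_pos n with rfl | hpos
  · obtain rfl := hP.natDegree_eq_zero.1 hn
    obtain ⟨ξ, hξ, hm⟩ := SignPattern.exists_mem (by simpa using h)
    exact ⟨ξ, hξ, by simpa [realDiffOp] using hm⟩
  · obtain ⟨z, hz⟩ : ∃ z : ℂ, aeval z P = 0 := by
      apply IsAlgClosed.exists_aeval_eq_zero
      rw [degree_eq_natDegree hP.ne_zero, hn]
      exact_mod_cast hpos.ne'
    by_cases hzi : z.im = 0
    · have hdvd : X - C z.re ∣ P := by
        rw [dvd_iff_isRoot]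
        have : z = algebraMap ℝ ℂ z.re := Complex.ext (by simp) (by simp [hzi])
        rw [this, aeval_algebraMap_apply] at hz
        simpa using hz
      obtain ⟨Q, rfl⟩ := hdvd
      have hQ : Q.Monic := (monic_X_sub_C _).of_mul_monic_left hP
      have hdeg : (X - C z.re : ℝ[X]).natDegree + Q.natDegree = n := by
        rw [← hn, (monic_X_sub_C _).natDegree_mul hQ]
      rw [natDegree_X_sub_C] at hdeg
      rw [hn, ← hdeg, add_comm] at h
      obtain ⟨ξ, hξ, hm⟩ := ih Q.natDegree (by omega) hQ
        (fun w hw => hroots w (by rw [map_mul, hw, mul_zero])) (h.linear_factor z.re hk hl)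
        (hk.deriv.sub ((hk.mono (Nat.sub_le _ _)).smul _))
        (hl.deriv.sub ((hl.mono (Nat.sub_le _ _)).smul _)) rfl
      refine ⟨ξ, hξ, ?_⟩
      have : realDiffOp ((X - C z.re) * Q) F =
          realDiffOp Q (derivOp F - (z.re : ℂ) • F) := by
        rw [realDiffOp, mul_comm, Polynomial.map_mul, map_mul, Module.End.mul_apply]
        simp only [Polynomial.map_sub, map_X, map_C, map_sub, aeval_X, aeval_C,
          Module.algebraMap_end_eq_smul_id, LinearMap.sub_apply, LinearMap.smul_apply,
          LinearMap.id_apply, Complex.coe_algebraMap]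
      rwa [this]
    · have hdvd := Polynomial.quadratic_dvd_of_aeval_eq_zero_im_ne_zero P hz hzi
      set R : ℝ[X] := X ^ 2 - C (2 * z.re) * X + C (‖z‖ ^ 2) with hR
      have hRdeg : R.natDegree = 2 := by rw [hR]; compute_degree!
      have hRm : R.Monic := by rw [hR]; monicity!
      obtain ⟨Q, rfl⟩ := hdvd
      have hQ : Q.Monic := hRm.of_mul_monic_left hP
      have hdeg : R.natDegree + Q.natDegree = n := by rw [← hn, hRm.natDegree_mul hQ]
      rw [hRdeg] at hdeg
      rw [hn, ← hdeg, add_comm] at h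
      obtain ⟨ξ, hξ, hm⟩ := ih Q.natDegree (by omega) hQ
        (fun w hw => hroots w (by rw [map_mul, hw, mul_zero]))
        (h.quadratic_factor z.re z.im (hroots z hz) hk hl)
        ((hk.deriv.deriv.sub ((hk.deriv.mono (Nat.sub_le _ _)).smul _)).add
          ((hk.mono (by omega)).smul _))
        ((hl.deriv.deriv.sub ((hl.deriv.mono (Nat.sub_le _ _)).smul _)).add
          ((hl.mono (by omega)).smul _)) rfl
      refine ⟨ξ, hξ, ?_⟩
      have : realDiffOp (R * Q) F = realDiffOp Q (derivOp (derivOp F) -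
          ((2 * z.re : ℝ) : ℂ) • derivOp F + ((z.re ^ 2 + z.im ^ 2 : ℝ) : ℂ) • F) := by
        rw [realDiffOp, mul_comm, Polynomial.map_mul, map_mul, Module.End.mul_apply]
        congr 1
        have hnorm : ‖z‖ ^ 2 = z.re ^ 2 + z.im ^ 2 := by
          rw [← Complex.normSq_eq_norm_sq, Complex.normSq_apply]; ring
        rw [hR, hnorm]
        simp only [Polynomial.map_add, Polynomial.map_sub, Polynomial.map_mul, map_X, map_C, map_add, map_sub, map_mul, aeval_X, aeval_C,
          Module.algebraMap_end_eq_smul_id, LinearMap.add_apply, LinearMap.sub_apply,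
          Module.End.mul_apply, LinearMap.smul_apply, LinearMap.id_apply, pow_two,
          Complex.coe_algebraMap, smul_smul, Complex.ofReal_add, Complex.ofReal_mul,
          add_smul]
      rwa [this]

end RealOperators

/-- The characteristic polynomial of `expDiffOp Λ`. -/
noncomputable def charPoly {m : ℕ} (Λ : Fin m → ℂ) : ℂ[X] := ∏ i, (X - C (Λ i))

section CharPoly

variable {m : ℕ} (Λ : Fin m → ℂ)

lemma charPoly_cons (c : ℂ) :
    charPoly (Fin.cons c Λ : Fin (m + 1) → ℂ) = (X - C c) * charPoly Λ := by
  simp [charPoly, Fin.prod_univ_succ]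

lemma monic_charPoly : (charPoly Λ).Monic := monic_prod_of_monic _ _ fun _ _ => monic_X_sub_C _

lemma natDegree_charPoly : (charPoly Λ).natDegree = m := by
  rw [charPoly, natDegree_prod_of_monic _ _ fun i _ => monic_X_sub_C _]
  simp

lemma aeval_X_sub_C_mul_apply (c : ℂ) (P : ℂ[X]) (F : smoothFun) :
    aeval derivOp ((X - C c) * P) F =
      derivOp (aeval derivOp P F) - c • aeval derivOp P F := by
  rw [map_mul, Module.End.mul_apply]
  simp [Module.algebraMap_end_eq_smul_id]

lemma aeval_X_sub_C_mul_apply' (c : ℂ) (P : ℂ[X]) (F : smoothFun) :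
    aeval derivOp ((X - C c) * P) F = aeval derivOp P (derivOp F - c • F) := by
  rw [mul_comm, map_mul, Module.End.mul_apply]
  simp [Module.algebraMap_end_eq_smul_id]

lemma expDiffOp_cons (c : ℂ) (f : ℝ → ℂ) :
    expDiffOp (Fin.cons c Λ : Fin (m + 1) → ℂ) f =
      fun x => deriv (expDiffOp Λ f) x - c * expDiffOp Λ f x := by
  simp [expDiffOp, List.ofFn_succ]

lemma expDiffOp_coe (F : smoothFun) :
    expDiffOp Λ F = (aeval derivOp (charPoly Λ) F : smoothFun) := by
  induction m with
  | zero => simp [expDiffOp, charPoly]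
  | succ m ih =>
    rw [← Fin.cons_self_tail Λ, expDiffOp_cons, charPoly_cons, aeval_X_sub_C_mul_apply, ih]
    rfl

lemma coe_mem_expPolySpace {F : smoothFun} :
    (F : ℝ → ℂ) ∈ expPolySpace Λ ↔ aeval derivOp (charPoly Λ) F = 0 := by
  constructor
  · rintro ⟨-, h⟩
    ext x
    have := h x
    rwa [expDiffOp_coe] at this
  · intro h
    refine ⟨F.2, fun x => ?_⟩
    rw [expDiffOp_coe, h]
    rfl

end CharPoly

section InitialValue

lemma eq_zero_of_derivOp_eq_smul {c : ℂ} {F : smoothFun} {a : ℝ} (h : derivOp F - c • F = 0)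
    (ha : (F : ℝ → ℂ) a = 0) : F = 0 := by
  have hd : ∀ x, (derivOp F : ℝ → ℂ) x = c * (F : ℝ → ℂ) x := fun x => by
    have := congrArg (fun G : smoothFun => (G : ℝ → ℂ) x) h
    simpa [sub_eq_zero] using this
  have h₁ : ∀ x : ℝ, HasDerivAt (fun x : ℝ => Complex.exp (-c * x) * (F : ℝ → ℂ) x) 0 x := by
    intro x
    have he : HasDerivAt (fun x : ℝ => Complex.exp (-c * x)) _ x :=
      ((Complex.ofRealCLM.hasDerivAt (x := x)).const_mul (-c)).cexp
    refine (he.mul (smoothFun.hasDerivAt F x)).congr_deriv ?_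
    rw [hd]
    simp; ring
  ext x
  have := is_const_of_deriv_eq_zero (fun x => (h₁ x).differentiableAt) (fun x => (h₁ x).deriv) x a
  simpa [ha, Complex.exp_ne_zero] using this

lemma exists_derivOp_sub_smul_eq (c v : ℂ) (G : smoothFun) (a : ℝ) :
    ∃ F : smoothFun, derivOp F - c • F = G ∧ (F : ℝ → ℂ) a = v := by
  have hexp : ∀ d : ℂ, ContDiff ℝ ∞ (fun x : ℝ => Complex.exp (d * x)) := fun d =>
    (contDiff_const.mul Complex.ofRealCLM.contDiff).cexp
  set g : ℝ → ℂ := fun t => Complex.exp (-c * t) * (G : ℝ → ℂ) t with hg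
  have hgc : ContDiff ℝ ∞ g := (hexp (-c)).mul (smoothFun.contDiff G)
  set I : ℝ → ℂ := fun x => ∫ t in a..x, g t with hI
  have hId : ∀ x, HasDerivAt I (g x) x := fun x =>
    intervalIntegral.integral_hasDerivAt_right (hgc.continuous.intervalIntegrable _ _)
      (hgc.continuous.stronglyMeasurableAtFilter _ _) hgc.continuous.continuousAt
  have hIc : ContDiff ℝ ∞ I := by
    refine contDiff_infty_iff_deriv.2 ⟨fun x => (hId x).differentiableAt, ?_⟩
    rwa [show deriv I = g from funext fun x => (hId x).deriv]
  let F : smoothFun := ⟨fun x => Complex.exp (c * x) * (Complex.exp (-c * a) * v + I x),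
    (hexp c).mul (contDiff_const.add hIc)⟩
  refine ⟨F, ?_, ?_⟩
  · ext x
    have he : HasDerivAt (fun x : ℝ => Complex.exp (c * x)) _ x :=
      ((Complex.ofRealCLM.hasDerivAt (x := x)).const_mul c).cexp
    have hF : deriv (F : ℝ → ℂ) x = _ := (he.mul ((hId x).const_add (Complex.exp (-c * a) * v))).deriv
    have hmul : Complex.exp (c * x) * Complex.exp (-c * x) = 1 := by
      rw [← Complex.exp_add]; simp
    change deriv (F : ℝ → ℂ) x - c * (F : ℝ → ℂ) x = (G : ℝ → ℂ) x
    rw [hF]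
    simp only [F, hg, Complex.ofRealCLM_apply, Complex.ofReal_one]
    linear_combination (G : ℝ → ℂ) x * hmul
  · change Complex.exp (c * a) * (Complex.exp (-c * a) * v + I a) = v
    rw [hI]
    simp only [intervalIntegral.integral_same, add_zero, ← mul_assoc, ← Complex.exp_add]
    simp

variable {m : ℕ} {Λ : Fin m → ℂ} {F : smoothFun} {a : ℝ}

lemma eq_zero_of_vanishesToOrder (h : aeval derivOp (charPoly Λ) F = 0)
    (ha : VanishesToOrder F m a) : F = 0 := by
  induction m generalizing F with
  | zero => simpa [charPoly] using h
  | succ m ih =>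
    rw [← Fin.cons_self_tail Λ, charPoly_cons, aeval_X_sub_C_mul_apply'] at h
    exact eq_zero_of_derivOp_eq_smul
      (ih h (ha.deriv.sub ((ha.mono (Nat.le_succ m)).smul _))) (ha.apply_eq_zero m.succ_pos)

variable (Λ a) in
lemma exists_initialValue (v : Fin m → ℂ) : ∃ F : smoothFun,
    aeval derivOp (charPoly Λ) F = 0 ∧ ∀ j : Fin m, ((derivOp ^ (j : ℕ)) F : ℝ → ℂ) a = v j := by
  induction m with
  | zero => exact ⟨0, map_zero _, fun j => j.elim0⟩
  | succ m ih =>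
    obtain ⟨G, hG, hGv⟩ := ih (Fin.tail Λ) (fun j => v j.succ - Λ 0 * v j.castSucc)
    obtain ⟨F, rfl, hFa⟩ := exists_derivOp_sub_smul_eq (Λ 0) (v 0) G a
    refine ⟨F, ?_, fun j => ?_⟩
    · rwa [← Fin.cons_self_tail Λ, charPoly_cons, aeval_X_sub_C_mul_apply']
    · induction j using Fin.induction with
      | zero => simpa using hFa
      | succ j ihj =>
        have := hGv j
        rw [map_sub, map_smul] at this
        rw [Fin.val_succ, pow_succ, Module.End.mul_apply]
        simp only [Submodule.coe_sub, Submodule.coe_smul, Pi.sub_apply, Pi.smul_apply,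
          smul_eq_mul] at this
        rw [Fin.val_castSucc] at ihj
        rw [ihj] at this
        exact sub_left_injective this

/-- The first `n` derivatives at `a`. -/
noncomputable def jet (n : ℕ) (a : ℝ) : smoothFun →ₗ[ℂ] (Fin n → ℂ) :=
  LinearMap.pi fun j => LinearMap.proj a ∘ₗ smoothFun.subtype ∘ₗ derivOp ^ (j : ℕ)

lemma jet_apply (n : ℕ) (a : ℝ) (F : smoothFun) (j : Fin n) :
    jet n a F j = ((derivOp ^ (j : ℕ)) F : ℝ → ℂ) a := rfl

lemma jet_eq_zero_iff {n : ℕ} : jet n a F = 0 ↔ VanishesToOrder F n a :=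
  ⟨fun h j hj => congrFun h ⟨j, hj⟩, fun h => funext fun j => h j j.2⟩

variable (Λ) in
/-- Solutions are parametrized by their initial values. -/
noncomputable def initialValueEquiv (a : ℝ) :
    LinearMap.ker (aeval derivOp (charPoly Λ)) ≃ₗ[ℂ] (Fin m → ℂ) :=
  LinearEquiv.ofBijective (jet m a ∘ₗ Submodule.subtype _) <| by
    constructor
    · refine (injective_iff_map_eq_zero _).2 fun F hF => ?_
      exact Subtype.ext (eq_zero_of_vanishesToOrder F.2 (jet_eq_zero_iff.1 hF))
    · intro v
      obtain ⟨F, hF, hv⟩ := exists_initialValue Λ a v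
      exact ⟨⟨F, hF⟩, funext hv⟩

lemma exists_jet_eq_of_injective {b : ℝ} {k l : ℕ} (hkl : k + l = m)
    (hinj : ∀ F : smoothFun, aeval derivOp (charPoly Λ) F = 0 → VanishesToOrder F k a →
      VanishesToOrder F l b → F = 0) (v : Fin k → ℂ) (w : Fin l → ℂ) :
    ∃ F : smoothFun, aeval derivOp (charPoly Λ) F = 0 ∧ jet k a F = v ∧ jet l b F = w := by
  let e := initialValueEquiv Λ a
  let Φ : (Fin m → ℂ) →ₗ[ℂ] (Fin k → ℂ) × (Fin l → ℂ) :=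
    ((jet k a).prod (jet l b)) ∘ₗ Submodule.subtype _ ∘ₗ e.symm.toLinearMap
  have hΦ : Function.Injective Φ := by
    refine (injective_iff_map_eq_zero _).2 fun c hc => ?_
    refine e.symm.map_eq_zero_iff.1 (Subtype.ext ?_)
    exact hinj _ (e.symm c).2 (jet_eq_zero_iff.1 (congrArg Prod.fst hc))
      (jet_eq_zero_iff.1 (congrArg Prod.snd hc))
  obtain ⟨c, hc⟩ := (LinearMap.injective_iff_surjective_of_finrank_eq_finrank
    (f := Φ) (by simp [hkl])).1 hΦ (v, w)
  exact ⟨e.symm c, (e.symm c).2, congrArg Prod.fst hc, congrArg Prod.snd hc⟩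

lemma eq_zero_of_degree_lt {R : ℂ[X]} (hR : R.degree < m)
    (h : ∀ F : smoothFun, aeval derivOp (charPoly Λ) F = 0 → aeval derivOp R F = 0) : R = 0 := by
  by_contra hR₀
  refine hR₀ (Polynomial.ext fun j => ?_)
  rw [coeff_zero]
  rcases le_or_gt m j with hj | hj
  · exact coeff_eq_zero_of_degree_lt (hR.trans_le (by exact_mod_cast hj))
  obtain ⟨F, hF, hv⟩ := exists_initialValue Λ 0 (Pi.single ⟨j, hj⟩ 1)
  have h₀ := congrArg (fun G : smoothFun => (G : ℝ → ℂ) 0) (h F hF)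
  rw [aeval_eq_sum_range' (n := m) ((natDegree_lt_iff_degree_lt hR₀).2 hR), Finset.sum_range] at h₀
  simp only [LinearMap.sum_apply, LinearMap.smul_apply, Submodule.coe_sum, Finset.sum_apply,
    Submodule.coe_smul, Pi.smul_apply, hv, smul_eq_mul] at h₀
  rw [Finset.sum_eq_single ⟨j, hj⟩ (fun i _ hi => by simp [hi]) (by simp)] at h₀
  simpa using h₀

end InitialValue

section Conj

open ComplexConjugate

/-- Complex conjugation of smooth functions. -/
noncomputable def conjFun : smoothFun →ₛₗ[starRingEnd ℂ] smoothFun where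
  toFun F := ⟨fun x => conj ((F : ℝ → ℂ) x),
    Complex.conjCLE.contDiff.comp (smoothFun.contDiff F)⟩
  map_add' F G := by ext x; simp
  map_smul' c F := by ext x; simp

lemma conjFun_apply (F : smoothFun) (x : ℝ) :
    (conjFun F : ℝ → ℂ) x = conj ((F : ℝ → ℂ) x) := rfl

lemma derivOp_conjFun (F : smoothFun) : derivOp (conjFun F) = conjFun (derivOp F) := by
  ext x
  exact (Complex.conjCLE.toContinuousLinearMap.hasFDerivAt.comp_hasDerivAt x
    (smoothFun.hasDerivAt F x)).deriv

lemma derivOp_pow_conjFun (j : ℕ) (F : smoothFun) :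
    (derivOp ^ j) (conjFun F) = conjFun ((derivOp ^ j) F) := by
  induction j with
  | zero => rfl
  | succ j ih =>
    rw [pow_succ', Module.End.mul_apply, ih, derivOp_conjFun, Module.End.mul_apply]

lemma aeval_conjFun (P : ℂ[X]) (F : smoothFun) :
    aeval derivOp (P.map (starRingEnd ℂ)) (conjFun F) = conjFun (aeval derivOp P F) := by
  induction P using Polynomial.induction_on' with
  | add P Q hP hQ => simp [hP, hQ]
  | monomial n c =>
    rw [map_monomial, aeval_monomial, aeval_monomial]
    simp [Module.algebraMap_end_eq_smul_id, derivOp_pow_conjFun, map_smulₛₗ]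

lemma realDiffOp_conjFun (P : ℝ[X]) (F : smoothFun) :
    realDiffOp P (conjFun F) = conjFun (realDiffOp P F) := by
  rw [← aeval_conjFun, Polynomial.map_map]
  have : (starRingEnd ℂ).comp (algebraMap ℝ ℂ) = algebraMap ℝ ℂ := by ext x; simp
  rw [this]

lemma VanishesToOrder.conjFun {F : smoothFun} {n : ℕ} {a : ℝ} (h : VanishesToOrder F n a) :
    VanishesToOrder (conjFun F) n a := fun j hj => by
  rw [derivOp_pow_conjFun, conjFun_apply, h j hj, map_zero]

lemma exists_map_eq_charPoly {m : ℕ} {Λ : Fin m → ℂ} (h : ClosedUnderConj (expPolySpace Λ)) :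
    ∃ P : ℝ[X], P.map (algebraMap ℝ ℂ) = charPoly Λ := by
  have hconj : charPoly Λ - (charPoly Λ).map (starRingEnd ℂ) = 0 := by
    refine eq_zero_of_degree_lt (Λ := Λ) ?_ fun F hF => ?_
    · have hdeg : (charPoly Λ).degree = m := by
        rw [degree_eq_natDegree (monic_charPoly Λ).ne_zero, natDegree_charPoly]
      rw [← hdeg]
      refine degree_sub_lt_left (degree_map _ _).symm (monic_charPoly Λ).ne_zero ?_
      rw [((monic_charPoly Λ).map _).leadingCoeff, (monic_charPoly Λ).leadingCoeff]
    · have h₁ : aeval derivOp (charPoly Λ) (conjFun F) = 0 :=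
        (coe_mem_expPolySpace Λ).1 (h F ((coe_mem_expPolySpace Λ).2 hF))
      have h₂ := aeval_conjFun (charPoly Λ) (conjFun F)
      have h₃ : conjFun (conjFun F) = F := by ext x; simp [conjFun_apply]
      rw [h₁, h₃, map_zero] at h₂
      rw [map_sub, LinearMap.sub_apply, hF, h₂, sub_zero]
  rw [sub_eq_zero] at hconj
  refine (mem_lifts _).1 ((lifts_iff_coeff_lifts _).2 fun n => ?_)
  have := congrArg (fun P => P.coeff n) hconj
  simp only [coeff_map] at this
  exact ⟨_, (Complex.conj_eq_iff_re.1 this.symm)⟩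

end Conj

section Disconjugate

variable {K : ConvexCone ℝ ℝ} {a b : ℝ} {F : smoothFun} {P : ℝ[X]} {k l : ℕ}

/-- The real operator with characteristic polynomial `P` is disconjugate on `[a, b]`, since its
characteristic roots have small imaginary parts. -/
structure SmallRoots (a b : ℝ) (P : ℝ[X]) : Prop where
  monic : P.Monic
  abs_im_mul_lt : ∀ z : ℂ, aeval z P = 0 → |z.im| * (b - a) < Real.pi

lemma SmallRoots.exists_mul_re_mem (hP : SmallRoots a b P) (hkl : k + l = P.natDegree)
    (hk : VanishesToOrder F k a) (hl : VanishesToOrder F l b) {x τ : ℝ} (hx : x ∈ Set.Ioo a b)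
    (hτ : τ * ((F : ℝ → ℂ) x).re ∈ K) :
    ∃ ξ ∈ Set.Ioo a b, τ * (-1) ^ l * ((realDiffOp P F : ℝ → ℂ) ξ).re ∈ K :=
  SignPattern.exists_realDiffOp_mem hP.monic hP.abs_im_mul_lt
    ⟨0, τ, x, by omega, rfl, hx.2, .base hx.1 hτ⟩ hk hl

lemma SmallRoots.re_eq_zero (hP : SmallRoots a b P) (hkl : k + l = P.natDegree)
    (hk : VanishesToOrder F k a) (hl : VanishesToOrder F l b) (hF : realDiffOp P F = 0)
    {x : ℝ} (hx : x ∈ Set.Ioo a b) : ((F : ℝ → ℂ) x).re = 0 := by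
  by_contra hne
  obtain ⟨ξ, -, h⟩ := hP.exists_mul_re_mem (K := ConvexCone.strictlyPositive ℝ ℝ)
    (τ := ((F : ℝ → ℂ) x).re) hkl hk hl hx (by
      rw [ConvexCone.mem_strictlyPositive]; exact mul_self_pos.2 hne)
  rw [ConvexCone.mem_strictlyPositive, hF] at h
  simp at h

lemma vanishesToOrder_of_eqOn {U : Set ℝ} (hU : IsOpen U) (h : ∀ x ∈ U, (F : ℝ → ℂ) x = 0)
    {x : ℝ} (hx : x ∈ U) (n : ℕ) : VanishesToOrder F n x := by
  have key : ∀ j, ∀ y ∈ U, ((derivOp ^ j) F : ℝ → ℂ) y = 0 := by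
    intro j
    induction j with
    | zero => exact h
    | succ j ih =>
      intro y hy
      rw [pow_succ', Module.End.mul_apply, derivOp_apply]
      have : (((derivOp ^ j) F : smoothFun) : ℝ → ℂ) =ᶠ[𝓝 y] fun _ => 0 :=
        Filter.eventually_of_mem (hU.mem_nhds hy) ih
      rw [this.deriv_eq, deriv_const]
  exact fun j _ => key j x hx

lemma SmallRoots.eq_zero {m : ℕ} {Λ : Fin m → ℂ} (hP : SmallRoots a b P) (hab : a < b)
    (hΛ : P.map (algebraMap ℝ ℂ) = charPoly Λ) (hkl : k + l = m)
    (hk : VanishesToOrder F k a) (hl : VanishesToOrder F l b) (hF : realDiffOp P F = 0) :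
    F = 0 := by
  have hdeg : k + l = P.natDegree := by
    rw [← natDegree_map (algebraMap ℝ ℂ), hΛ, natDegree_charPoly, hkl]
  have h₀ : ∀ x ∈ Set.Ioo a b, (F : ℝ → ℂ) x = 0 := by
    intro x hx
    refine Complex.ext (hP.re_eq_zero hdeg hk hl hF hx) ?_
    have := hP.re_eq_zero hdeg (hk.smul (-Complex.I)) (hl.smul (-Complex.I))
      (by rw [map_smul, hF, smul_zero]) hx
    simpa using this
  refine eq_zero_of_vanishesToOrder (Λ := Λ) (by rwa [← hΛ])
    (vanishesToOrder_of_eqOn isOpen_Ioo h₀ (x := (a + b) / 2) ⟨by linarith, by linarith⟩ m)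

end Disconjugate

/-- The `k`-th normalized Bernstein function of the kernel of the real operator with
characteristic polynomial `P`, where `k + l` is the degree of `P` minus one. -/
structure IsBernsteinFun (P : ℝ[X]) (a b : ℝ) (k l : ℕ) (F : smoothFun) : Prop where
  realDiffOp_eq_zero : realDiffOp P F = 0
  left : VanishesToOrder F k a
  right : VanishesToOrder F l b
  normalized : ((derivOp ^ k) F : ℝ → ℂ) a = 1

lemma VanishesToOrder.succ {F : smoothFun} {n : ℕ} {a : ℝ} (h : VanishesToOrder F n a)
    (hn : ((derivOp ^ n) F : ℝ → ℂ) a = 0) : VanishesToOrder F (n + 1) a := by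
  intro j hj
  rcases Nat.lt_succ_iff_lt_or_eq.1 hj with hj | rfl
  exacts [h j hj, hn]

namespace IsBernsteinFun

variable {P : ℝ[X]} {a b : ℝ} {k l m : ℕ} {F G : smoothFun} {Λ : Fin (m + 1) → ℂ}

lemma sub_left {P' : ℝ[X]} (hF : IsBernsteinFun P a b k l F) (hG : IsBernsteinFun P' a b k l G) :
    VanishesToOrder (F - G) (k + 1) a :=
  (hF.left.sub hG.left).succ (by
    rw [map_sub, Submodule.coe_sub, Pi.sub_apply, hF.normalized, hG.normalized, sub_self])

lemma unique (hP : SmallRoots a b P) (hab : a < b) (hΛ : P.map (algebraMap ℝ ℂ) = charPoly Λ)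
    (hkl : k + l = m) (hF : IsBernsteinFun P a b k l F) (hG : IsBernsteinFun P a b k l G) :
    F = G :=
  sub_eq_zero.1 <| hP.eq_zero hab hΛ (by omega) (hF.sub_left hG) (hF.right.sub hG.right)
    (by rw [map_sub, hF.realDiffOp_eq_zero, hG.realDiffOp_eq_zero, sub_zero])

lemma ne_zero_right (hP : SmallRoots a b P) (hab : a < b)
    (hΛ : P.map (algebraMap ℝ ℂ) = charPoly Λ) (hkl : k + l = m)
    (hF : IsBernsteinFun P a b k l F) : ((derivOp ^ l) F : ℝ → ℂ) b ≠ 0 := by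
  intro h
  have h₀ := hP.eq_zero hab hΛ (by omega) hF.left (hF.right.succ h) hF.realDiffOp_eq_zero
  have := hF.normalized
  rw [h₀, map_zero] at this
  simp at this

lemma exists_of_smallRoots (hP : SmallRoots a b P) (hab : a < b)
    (hΛ : P.map (algebraMap ℝ ℂ) = charPoly Λ) (hkl : k + l = m) :
    ∃ F, IsBernsteinFun P a b k l F := by
  obtain ⟨F, hF, hv, hw⟩ := exists_jet_eq_of_injective (Λ := Λ) (a := a) (b := b) (k := k + 1)
    (l := l) (by omega)
    (fun F hF hk hl => hP.eq_zero hab hΛ (by omega) hk hl (by rwa [realDiffOp, hΛ]))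
    (Pi.single (Fin.last k) 1) 0
  refine ⟨F, by rwa [realDiffOp, hΛ], fun j hj => ?_, jet_eq_zero_iff.1 hw, ?_⟩
  · have := congrFun hv ⟨j, by omega⟩
    rw [jet_apply] at this
    rw [this, Pi.single_eq_of_ne]
    exact fun h => hj.ne (congrArg Fin.val h)
  · have := congrFun hv (Fin.last k)
    rw [jet_apply, Pi.single_eq_same] at this
    exact this

lemma conjFun_eq (hP : SmallRoots a b P) (hab : a < b)
    (hΛ : P.map (algebraMap ℝ ℂ) = charPoly Λ) (hkl : k + l = m)
    (hF : IsBernsteinFun P a b k l F) : conjFun F = F :=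
  unique hP hab hΛ hkl ⟨by rw [realDiffOp_conjFun, hF.realDiffOp_eq_zero, map_zero],
    hF.left.conjFun, hF.right.conjFun, by
      rw [derivOp_pow_conjFun, conjFun_apply, hF.normalized, map_one]⟩ hF

end IsBernsteinFun

lemma im_derivOp_pow_eq_zero {F : smoothFun} (hF : conjFun F = F) (j : ℕ) (x : ℝ) :
    (((derivOp ^ j) F : ℝ → ℂ) x).im = 0 := by
  rw [← Complex.conj_eq_iff_im, ← conjFun_apply, ← derivOp_pow_conjFun, hF]

section Local

variable {F : smoothFun} {n : ℕ} {b : ℝ}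

lemma VanishesToOrder.tendsto_div_pow (h : VanishesToOrder F n b) :
    Filter.Tendsto (fun x : ℝ => (F : ℝ → ℂ) x / ((x - b : ℝ) : ℂ) ^ n) (𝓝[≠] b)
      (𝓝 (((derivOp ^ n) F : ℝ → ℂ) b / n.factorial)) := by
  have ht := taylor_isLittleO (n := n) convex_univ (Set.mem_univ b)
    ((smoothFun.contDiff F).contDiffOn.of_le (by exact_mod_cast le_top))
  rw [nhdsWithin_univ] at ht
  have hT : ∀ x, taylorWithinEval (F : ℝ → ℂ) n Set.univ b x =
      ((x - b : ℝ) : ℂ) ^ n * (((derivOp ^ n) F : ℝ → ℂ) b / n.factorial) := by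
    intro x
    rw [taylor_within_apply, Finset.sum_range_succ, Finset.sum_eq_zero, zero_add]
    · rw [iteratedDerivWithin_univ, ← derivOp_pow_apply, Complex.real_smul]
      push_cast
      ring
    · intro j hj
      rw [iteratedDerivWithin_univ, ← derivOp_pow_apply, h j (Finset.mem_range.1 hj), smul_zero]
  have ht' : (fun x => (F : ℝ → ℂ) x - taylorWithinEval (F : ℝ → ℂ) n Set.univ b x) =o[𝓝[≠] b]
      fun x => ((x - b : ℝ) : ℂ) ^ n := by
    refine (ht.mono nhdsWithin_le_nhds).trans_isBigO (Asymptotics.IsBigO.of_bound 1 ?_)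
    exact Filter.Eventually.of_forall fun x => by
      rw [norm_pow, norm_pow, one_mul, Complex.norm_real]
  have h₁ := ht'.tendsto_div_nhds_zero.add_const (((derivOp ^ n) F : ℝ → ℂ) b / n.factorial)
  rw [zero_add] at h₁
  refine h₁.congr' ?_
  filter_upwards [self_mem_nhdsWithin] with x hx
  have hne : ((x - b : ℝ) : ℂ) ^ n ≠ 0 :=
    pow_ne_zero _ (Complex.ofReal_ne_zero.2 (sub_ne_zero.2 hx))
  rw [hT, sub_div, mul_div_cancel_left₀ _ hne, sub_add_cancel]

lemma VanishesToOrder.eventually_re_pos (h : VanishesToOrder F n b)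
    (hpos : 0 < (((derivOp ^ n) F : ℝ → ℂ) b).re) : ∀ᶠ x in 𝓝[>] b, 0 < ((F : ℝ → ℂ) x).re := by
  have ht := (Complex.continuous_re.tendsto _).comp
    (h.tendsto_div_pow.mono_left (nhdsWithin_mono b fun x (hx : x ∈ Set.Ioi b) => hx.ne'))
  have hlim : 0 < (((derivOp ^ n) F : ℝ → ℂ) b / n.factorial).re := by
    rw [Complex.div_natCast_re]; positivity
  filter_upwards [ht.eventually_const_lt hlim, self_mem_nhdsWithin] with x hx (hbx : b < x)
  have hp : (0 : ℝ) < (x - b) ^ n := pow_pos (sub_pos.2 hbx) n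
  rw [Function.comp_apply, ← Complex.ofReal_pow, Complex.div_ofReal_re] at hx
  exact (div_pos_iff_of_pos_right hp).1 hx

lemma VanishesToOrder.nonneg_of_pos_left (h : VanishesToOrder F n b) {a : ℝ} (hab : a < b)
    (hpos : ∀ x ∈ Set.Ioo a b, 0 < ((F : ℝ → ℂ) x).re) :
    0 ≤ (-1) ^ n * (((derivOp ^ n) F : ℝ → ℂ) b).re := by
  have ht := (Complex.continuous_re.tendsto _).comp
    (h.tendsto_div_pow.mono_left (nhdsWithin_mono b fun x (hx : x ∈ Set.Iio b) => hx.ne))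
  have hlim : 0 ≤ (-1) ^ n * (((derivOp ^ n) F : ℝ → ℂ) b / n.factorial).re := by
    refine ge_of_tendsto (ht.const_mul ((-1 : ℝ) ^ n)) ?_
    filter_upwards [Ioo_mem_nhdsLT hab] with x hx
    rw [Function.comp_apply, ← Complex.ofReal_pow, Complex.div_ofReal_re]
    have h₁ : (x - b) ^ n = (-1) ^ n * (b - x) ^ n := by rw [← mul_pow]; ring
    have h₂ : (0 : ℝ) < (b - x) ^ n := pow_pos (sub_pos.2 hx.2) n
    have h₃ : ((-1 : ℝ) ^ n) ≠ 0 := by simp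
    rw [h₁, mul_div_assoc', mul_div_mul_left _ _ h₃]
    exact div_nonneg (hpos x hx).le h₂.le
  rw [Complex.div_natCast_re, ← mul_div_assoc] at hlim
  have := mul_nonneg hlim (Nat.cast_nonneg (α := ℝ) n.factorial)
  rwa [div_mul_cancel₀ _ (by positivity)] at this

end Local

section Comparison

variable {a b : ℝ} {F G : smoothFun} {P Q : ℝ[X]} {k l m : ℕ} {Λ : Fin m → ℂ}

lemma SmallRoots.X_sub_C_mul (hQ : SmallRoots a b Q) (c : ℝ) :
    SmallRoots a b ((X - C c) * Q) where
  monic := (monic_X_sub_C c).mul hQ.monic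
  abs_im_mul_lt z hz := by
    rw [map_mul, mul_eq_zero] at hz
    rcases hz with hz | hz
    · have : z = c := by simpa [sub_eq_zero] using hz
      simp [this, Real.pi_pos]
    · exact hQ.abs_im_mul_lt z hz

lemma map_X_sub_C_mul (hQ : Q.map (algebraMap ℝ ℂ) = charPoly Λ) (c : ℝ) :
    ((X - C c) * Q).map (algebraMap ℝ ℂ) =
      charPoly (Fin.cons (c : ℂ) Λ : Fin (m + 1) → ℂ) := by
  rw [charPoly_cons, Polynomial.map_mul, hQ]
  simp

lemma realDiffOp_X_sub_C_mul (c : ℝ) (Q : ℝ[X]) (F : smoothFun) :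
    realDiffOp ((X - C c) * Q) F = derivOp (realDiffOp Q F) - (c : ℂ) • realDiffOp Q F := by
  rw [realDiffOp, Polynomial.map_mul, Polynomial.map_sub, map_X, map_C,
    aeval_X_sub_C_mul_apply]
  rfl

lemma mul_re_pos_of_derivOp_eq_smul {c : ℝ} {s : ℝ} (h : derivOp F - (c : ℂ) • F = 0) {y : ℝ}
    (hy : 0 < s * ((F : ℝ → ℂ) y).re) (x : ℝ) : 0 < s * ((F : ℝ → ℂ) x).re := by
  have hd : ∀ x, ((derivOp F : ℝ → ℂ) x).re = c * ((F : ℝ → ℂ) x).re := fun x => by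
    have := congrArg (fun G : smoothFun => ((G : ℝ → ℂ) x).re) h
    simpa [sub_eq_zero] using this
  have h₁ : ∀ x, HasDerivAt (fun x => Real.exp (-c * x) * ((F : ℝ → ℂ) x).re) 0 x := by
    intro x
    refine ((((hasDerivAt_id x).const_mul (-c)).exp).mul
      (smoothFun.hasDerivAt_re F x)).congr_deriv ?_
    rw [hd]
    simp; ring
  have h₂ := is_const_of_deriv_eq_zero (fun x => (h₁ x).differentiableAt)
    (fun x => (h₁ x).deriv) x y
  have h₃ : 0 < Real.exp (-c * x) * (s * ((F : ℝ → ℂ) x).re) := by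
    have : Real.exp (-c * x) * (s * ((F : ℝ → ℂ) x).re) =
      Real.exp (-c * y) * (s * ((F : ℝ → ℂ) y).re) := by linear_combination s * h₂
    rw [this]
    exact mul_pos (Real.exp_pos _) hy
  exact (mul_pos_iff_of_pos_left (Real.exp_pos _)).1 h₃

lemma SmallRoots.re_pos (hP : SmallRoots a b P) (hkl : k + l = P.natDegree)
    (hk : VanishesToOrder F k a) (hl : VanishesToOrder F l b)
    (hF : ∀ x, 0 < (-1) ^ l * ((realDiffOp P F : ℝ → ℂ) x).re) {x : ℝ} (hx : x ∈ Set.Ioo a b) :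
    0 < ((F : ℝ → ℂ) x).re := by
  by_contra! hneg
  obtain ⟨ξ, -, h⟩ := hP.exists_mul_re_mem (K := ConvexCone.positive ℝ ℝ) (τ := -1) hkl hk hl hx
    (by rw [ConvexCone.mem_positive]; linarith)
  rw [ConvexCone.mem_positive] at h
  linarith [hF ξ]

lemma SmallRoots.right_ne_zero (hP : SmallRoots a b P) (hab : a < b)
    (hkl : k + 1 + l = P.natDegree)
    (hk : VanishesToOrder F (k + 1) a) (hl : VanishesToOrder F l b)
    (hF : ∀ x, 0 < (-1) ^ l * ((realDiffOp P F : ℝ → ℂ) x).re) :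
    ((derivOp ^ l) F : ℝ → ℂ) b ≠ 0 := by
  intro h₀
  have hx : (a + b) / 2 ∈ Set.Ioo a b := ⟨by linarith, by linarith⟩
  obtain ⟨ξ, -, h⟩ := hP.exists_mul_re_mem (K := ConvexCone.positive ℝ ℝ) (τ := 1) (k := k)
    (l := l + 1) (by omega) (hk.mono k.le_succ) (hl.succ h₀) hx
    (by rw [ConvexCone.mem_positive, one_mul]; exact (hP.re_pos hkl hk hl hF hx).le)
  rw [ConvexCone.mem_positive, pow_succ] at h
  linarith [hF ξ]

namespace IsBernsteinFun

lemma realDiffOp_re_pos (hQ : SmallRoots a b Q) (hab : a < b) (hkl : k + l = Q.natDegree) {c : ℝ}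
    (hF : IsBernsteinFun ((X - C c) * Q) a b k l F) (x : ℝ) :
    0 < (-1) ^ l * ((realDiffOp Q F : ℝ → ℂ) x).re := by
  have h₀ := hF.realDiffOp_eq_zero
  rw [realDiffOp_X_sub_C_mul] at h₀
  obtain ⟨y, hy, hyp⟩ := (Filter.Eventually.and (Ioo_mem_nhdsGT hab)
    (hF.left.eventually_re_pos (by rw [hF.normalized]; simp))).exists
  obtain ⟨ξ, -, h⟩ := hQ.exists_mul_re_mem (K := ConvexCone.strictlyPositive ℝ ℝ) (τ := 1)
    hkl hF.left hF.right hy (by rwa [ConvexCone.mem_strictlyPositive, one_mul])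
  rw [ConvexCone.mem_strictlyPositive, one_mul] at h
  exact mul_re_pos_of_derivOp_eq_smul h₀ h x

variable {c₀ c₁ : ℝ} {F₀ F₁ : smoothFun}

lemma realDiffOp_sub_re_pos (hQ : SmallRoots a b Q) (hab : a < b) (hkl : k + l = Q.natDegree)
    (hc : c₀ < c₁) (h₀ : IsBernsteinFun ((X - C c₀) * Q) a b k l F₀)
    (h₁ : IsBernsteinFun ((X - C c₁) * Q) a b k l F₁) (x : ℝ) :
    0 < (-1) ^ l * ((realDiffOp ((X - C c₀) * Q) (F₁ - F₀) : ℝ → ℂ) x).re := by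
  have e₁ := h₁.realDiffOp_eq_zero
  rw [realDiffOp_X_sub_C_mul, sub_eq_zero] at e₁
  have : realDiffOp ((X - C c₀) * Q) (F₁ - F₀) = ((c₁ - c₀ : ℝ) : ℂ) • realDiffOp Q F₁ := by
    rw [map_sub, h₀.realDiffOp_eq_zero, sub_zero, realDiffOp_X_sub_C_mul, e₁]
    ext x
    simp [sub_mul]
  rw [this, Submodule.coe_smul, Pi.smul_apply, smul_eq_mul, Complex.re_ofReal_mul, mul_left_comm]
  exact mul_pos (sub_pos.2 hc) (h₁.realDiffOp_re_pos hQ hab hkl x)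

lemma natDegree_X_sub_C_mul (hQ : SmallRoots a b Q) (hkl : k + l = Q.natDegree) (c : ℝ) :
    k + 1 + l = ((X - C c) * Q).natDegree := by
  rw [(monic_X_sub_C c).natDegree_mul hQ.monic, natDegree_X_sub_C]
  omega

lemma re_lt_re (hQ : SmallRoots a b Q) (hab : a < b) (hkl : k + l = Q.natDegree)
    (hc : c₀ < c₁) (h₀ : IsBernsteinFun ((X - C c₀) * Q) a b k l F₀)
    (h₁ : IsBernsteinFun ((X - C c₁) * Q) a b k l F₁) {x : ℝ} (hx : x ∈ Set.Ioo a b) :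
    ((F₀ : ℝ → ℂ) x).re < ((F₁ : ℝ → ℂ) x).re := by
  have := (hQ.X_sub_C_mul c₀).re_pos (natDegree_X_sub_C_mul hQ hkl c₀) (h₁.sub_left h₀)
    (h₁.right.sub h₀.right) (realDiffOp_sub_re_pos hQ hab hkl hc h₀ h₁) hx
  simpa using this

lemma exists_tendsto_div (hQ : SmallRoots a b Q) (hab : a < b)
    (hΛ : Q.map (algebraMap ℝ ℂ) = charPoly Λ) (hkl : k + l = m) (hc : c₀ < c₁)
    (h₀ : IsBernsteinFun ((X - C c₀) * Q) a b k l F₀)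
    (h₁ : IsBernsteinFun ((X - C c₁) * Q) a b k l F₁) :
    ∃ L : ℝ, L < 1 ∧ Filter.Tendsto (fun x => (F₀ : ℝ → ℂ) x / (F₁ : ℝ → ℂ) x)
      (𝓝[≠] b) (𝓝 (L : ℂ)) := by
  have hdeg : k + l = Q.natDegree := by
    rw [← natDegree_map (algebraMap ℝ ℂ), hΛ, natDegree_charPoly, hkl]
  set d₀ := ((derivOp ^ l) F₀ : ℝ → ℂ) b with hd₀
  set d₁ := ((derivOp ^ l) F₁ : ℝ → ℂ) b with hd₁
  have hreal : ∀ {c : ℝ} {F : smoothFun}, IsBernsteinFun ((X - C c) * Q) a b k l F →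
      (((derivOp ^ l) F : ℝ → ℂ) b).im = 0 := fun {c} _ hF =>
    im_derivOp_pow_eq_zero
      (hF.conjFun_eq (hQ.X_sub_C_mul c) hab (map_X_sub_C_mul hΛ c) hkl) l b
  have hr₀ : d₀ = (d₀.re : ℂ) := Complex.ext rfl (by simpa using hreal h₀)
  have hr₁ : d₁ = (d₁.re : ℂ) := Complex.ext rfl (by simpa using hreal h₁)
  have hne₁ : d₁ ≠ 0 :=
    h₁.ne_zero_right (hQ.X_sub_C_mul c₁) hab (map_X_sub_C_mul hΛ c₁) hkl
  have hpos : ∀ x, 0 < (-1) ^ l * ((realDiffOp ((X - C c₀) * Q) (F₁ - F₀) : ℝ → ℂ) x).re :=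
    realDiffOp_sub_re_pos hQ hab hdeg hc h₀ h₁
  have hsub : ((derivOp ^ l) (F₁ - F₀) : ℝ → ℂ) b = d₁ - d₀ := by
    rw [map_sub]; rfl
  have hne : d₁ - d₀ ≠ 0 := by
    rw [← hsub]
    exact (hQ.X_sub_C_mul c₀).right_ne_zero hab (natDegree_X_sub_C_mul hQ hdeg c₀)
      (h₁.sub_left h₀) (h₁.right.sub h₀.right) hpos
  have hnn₁ : 0 ≤ (-1) ^ l * d₁.re := h₁.right.nonneg_of_pos_left hab fun x hx =>
    hQ.re_pos hdeg h₁.left h₁.right (h₁.realDiffOp_re_pos hQ hab hdeg) hx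
  have hnn : 0 ≤ (-1) ^ l * (d₁ - d₀).re := by
    rw [← hsub]
    exact (h₁.right.sub h₀.right).nonneg_of_pos_left hab fun x hx =>
      (hQ.X_sub_C_mul c₀).re_pos (natDegree_X_sub_C_mul hQ hdeg c₀) (h₁.sub_left h₀)
        (h₁.right.sub h₀.right) hpos hx
  have hs : ((-1 : ℝ) ^ l) ≠ 0 := by simp
  have hp₁ : 0 < (-1) ^ l * d₁.re := lt_of_le_of_ne hnn₁ (Ne.symm (mul_ne_zero hs fun h =>
    hne₁ (by rw [hr₁, h, Complex.ofReal_zero])))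
  have hp : 0 < (-1) ^ l * (d₁.re - d₀.re) := lt_of_le_of_ne hnn (Ne.symm (mul_ne_zero hs fun h =>
    hne (by rw [hr₁, hr₀, ← Complex.ofReal_sub, h, Complex.ofReal_zero])))
  refine ⟨d₀.re / d₁.re, ?_, ?_⟩
  · rw [← mul_div_mul_left _ _ hs, div_lt_one hp₁]
    linarith
  · have hf : (l.factorial : ℂ) ≠ 0 := by exact_mod_cast l.factorial_ne_zero
    have ht := h₀.right.tendsto_div_pow.div h₁.right.tendsto_div_pow (div_ne_zero hne₁ hf)
    rw [← hd₀, ← hd₁, div_div_div_cancel_right₀ hf, hr₀, hr₁, ← Complex.ofReal_div] at ht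
    refine ht.congr' ?_
    filter_upwards [self_mem_nhdsWithin] with x hx
    exact div_div_div_cancel_right₀
      (pow_ne_zero _ (Complex.ofReal_ne_zero.2 (sub_ne_zero.2 hx))) _ _

end IsBernsteinFun

end Comparison

section Basis

variable {a b : ℝ} {P : ℝ[X]} {m : ℕ} {Λ : Fin (m + 1) → ℂ} {p : Fin (m + 1) → ℝ → ℂ}

lemma IsBernsteinBasis.exists_isBernsteinFun (hΛ : P.map (algebraMap ℝ ℂ) = charPoly Λ)
    (h : IsBernsteinBasis Λ a b p) (k : Fin (m + 1)) :
    ∃ F : smoothFun, (F : ℝ → ℂ) = p k ∧ IsBernsteinFun P a b k (m - k) F := by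
  obtain ⟨hE, ha, hb, hn⟩ := h k
  refine ⟨⟨p k, hE.1⟩, rfl, ?_, fun j hj => ?_, fun j hj => ?_, ?_⟩
  · rw [realDiffOp, hΛ]
    exact (coe_mem_expPolySpace Λ).1 hE
  · rw [derivOp_pow_apply]; exact ha.1 j hj
  · rw [derivOp_pow_apply]; exact hb.1 j hj
  · rw [derivOp_pow_apply]; exact hn

lemma isBernsteinBasis_of_isBernsteinFun (hP : SmallRoots a b P) (hab : a < b)
    (hΛ : P.map (algebraMap ℝ ℂ) = charPoly Λ) {F : Fin (m + 1) → smoothFun}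
    (hF : ∀ k : Fin (m + 1), IsBernsteinFun P a b k (m - k) (F k)) :
    IsBernsteinBasis Λ a b fun k => F k := by
  intro k
  have hn := (hF k).normalized
  rw [derivOp_pow_apply] at hn
  refine ⟨?_, ⟨fun j hj => ?_, ?_⟩, ⟨fun j hj => ?_, ?_⟩, hn⟩
  · rw [coe_mem_expPolySpace, ← hΛ]
    exact (hF k).realDiffOp_eq_zero
  · rw [← derivOp_pow_apply]; exact (hF k).left j hj
  · rw [hn]; exact one_ne_zero
  · rw [← derivOp_pow_apply]; exact (hF k).right j hj
  · rw [← derivOp_pow_apply]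
    exact (hF k).ne_zero_right hP hab hΛ (by omega)

lemma existsUnique_isBernsteinBasis (hP : SmallRoots a b P) (hab : a < b)
    (hΛ : P.map (algebraMap ℝ ℂ) = charPoly Λ) : ∃! p, IsBernsteinBasis Λ a b p := by
  choose F hF using fun k : Fin (m + 1) =>
    IsBernsteinFun.exists_of_smallRoots (k := k) (l := m - k) hP hab hΛ (by omega)
  refine ⟨_, isBernsteinBasis_of_isBernsteinFun hP hab hΛ hF, fun q hq => funext fun k => ?_⟩
  obtain ⟨G, hG, hGB⟩ := hq.exists_isBernsteinFun hΛ k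
  rw [← hG, hGB.unique hP hab hΛ (by omega) (hF k)]

lemma exists_coe_eq_bernsteinFun (hP : SmallRoots a b P) (hab : a < b)
    (hΛ : P.map (algebraMap ℝ ℂ) = charPoly Λ) (k : Fin (m + 1)) :
    ∃ F : smoothFun, (F : ℝ → ℂ) = bernsteinFun Λ a b k ∧ IsBernsteinFun P a b k (m - k) F := by
  have h := (existsUnique_isBernsteinBasis hP hab hΛ).exists
  rw [bernsteinFun, dif_pos h]
  exact h.choose_spec.exists_isBernsteinFun hΛ k

end Basis

lemma smallRoots_of_map_eq_charPoly {m : ℕ} {Λ : Fin m → ℂ} {a b : ℝ} (hab : 0 < b - a)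
    (hM : (b - a) * maxAbsIm Λ < Real.pi) {Q : ℝ[X]}
    (hQ : Q.map (algebraMap ℝ ℂ) = charPoly Λ) : SmallRoots a b Q where
  monic := (monic_map_iff (f := algebraMap ℝ ℂ)).1 (hQ ▸ monic_charPoly Λ)
  abs_im_mul_lt z hz := by
    rw [← eval_map_algebraMap, hQ, charPoly, eval_prod, Finset.prod_eq_zero_iff] at hz
    obtain ⟨j, -, hj⟩ := hz
    have hzj : z = Λ j := by simpa [sub_eq_zero] using hj
    have hle : |z.im| ≤ maxAbsIm Λ := by
      rw [hzj]
      exact le_ciSup (f := fun j => |(Λ j).im|) (Set.finite_range _).bddAbove j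
    rw [mul_comm]
    exact (mul_le_mul_of_nonneg_left hle hab.le).trans_lt hM

/-- Here `Λ` is the tuple `(λ₂, …, λₙ)` with `m = n - 1 ≥ 0` entries, `Fin.cons μ Λ` is
`(μ, λ₂, …, λₙ)`, and the condition `b - a < π / M` is written as `(b - a) * M < π`, so that it
imposes nothing if `M = 0`. -/
theorem theorem3p6 {m : ℕ} (Λ : Fin m → ℂ) (hΛ : ClosedUnderConj (expPolySpace Λ))
    (a b : ℝ) (hab : 0 < b - a) (hM : (b - a) * maxAbsIm Λ < Real.pi) :
    -- the Bernstein bases exist and are unique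
    (∀ μ : ℝ, ∃! p : Fin (m + 1) → ℝ → ℂ,
      IsBernsteinBasis (Fin.cons (μ : ℂ) Λ : Fin (m + 1) → ℂ) a b p) ∧
    -- the limit of the quotient at `b` exists, is real, and is less than `1`
    (∀ (k : Fin (m + 1)) (l₀ l₁ : ℝ), l₀ < l₁ →
      ∃ L : ℝ, L < 1 ∧
        Filter.Tendsto
          (fun x : ℝ => bernsteinFun (Fin.cons (l₀ : ℂ) Λ : Fin (m + 1) → ℂ) a b k x /
            bernsteinFun (Fin.cons (l₁ : ℂ) Λ : Fin (m + 1) → ℂ) a b k x)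
          (𝓝[≠] b) (𝓝 (L : ℂ))) ∧
    -- the values on `(a, b)` are real and strictly increasing in the real eigenvalue
    (∀ (k : Fin (m + 1)) (x : ℝ), x ∈ Set.Ioo a b →
      (∀ μ : ℝ, (bernsteinFun (Fin.cons (μ : ℂ) Λ : Fin (m + 1) → ℂ) a b k x).im = 0) ∧
      StrictMono
        (fun μ : ℝ => (bernsteinFun (Fin.cons (μ : ℂ) Λ : Fin (m + 1) → ℂ) a b k x).re)) := by
  obtain ⟨Q, hQ⟩ := exists_map_eq_charPoly hΛ
  have hS := smallRoots_of_map_eq_charPoly hab hM hQ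
  have hab' : a < b := sub_pos.1 hab
  have hdeg : Q.natDegree = m := by
    rw [← natDegree_map (algebraMap ℝ ℂ), hQ, natDegree_charPoly]
  have hB := fun (c : ℝ) (k : Fin (m + 1)) =>
    exists_coe_eq_bernsteinFun (hS.X_sub_C_mul c) hab' (map_X_sub_C_mul hQ c) k
  refine ⟨fun μ => existsUnique_isBernsteinBasis (hS.X_sub_C_mul μ) hab' (map_X_sub_C_mul hQ μ),
    fun k l₀ l₁ hl => ?_, fun k x hx => ⟨fun μ => ?_, fun l₀ l₁ hl => ?_⟩⟩
  · obtain ⟨F₀, e₀, h₀⟩ := hB l₀ k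
    obtain ⟨F₁, e₁, h₁⟩ := hB l₁ k
    rw [← e₀, ← e₁]
    exact IsBernsteinFun.exists_tendsto_div hS hab' hQ (by omega) hl h₀ h₁
  · obtain ⟨F, e, h⟩ := hB μ k
    rw [← e]
    exact im_derivOp_pow_eq_zero
      (h.conjFun_eq (hS.X_sub_C_mul μ) hab' (map_X_sub_C_mul hQ μ) (by omega)) 0 x
  · obtain ⟨F₀, e₀, h₀⟩ := hB l₀ k
    obtain ⟨F₁, e₁, h₁⟩ := hB l₁ k
    simp only [← e₀, ← e₁]
    exact IsBernsteinFun.re_lt_re hS hab' (by omega) hl h₀ h₁ hx
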